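/- Let $n\ge 0$ be an integer, let $M\in\mathbb R^{n\times n}$ (not necessarily symmetric) and $q\in\mathbb R^n$, and write $\mathtt{fea}(M,q)=\{x\in\mathbb R^n: x\ge 0,\ Mx+q\ge 0\}$ and $\mathtt{sol}(M,q)=\{x\in\mathbb R^n: x\ge 0,\ Mx+q\ge 0,\ \langle x,Mx+q\rangle=0\}$, where inequalities between vectors are componentwise. For a real number $r\ge 2$ put $$f_r(x)=\sum_{i=1}^n\phi_r\big(x_i,(Mx+q)_i\big),\qquad \phi_r(a,b)=\frac1r\Big[a_+^r\,b_+^r+(-a)_+^r+(-b)_+^r\Big],\qquad t_+=\max\{t,0\},$$ and let $\mathcal G_f=\{x\in\mathbb R^n:\ f_r \text{ is differentiable at } x \text{ and } \nabla f_r(x)=0\}$ be the set of stationary points of $f_r$. Then, for every $r\ge 2$: 1) If $M$ is positive semidefinite, i.e. $\langle x,Mx\rangle\ge 0$ for all $x\in\mathbb R^n$, and $\mathtt{fea}(M,q)\neq\emptyset$, then $\mathtt{sol}(M,q)=\mathcal G_f$, and this set is nonempty. 2) If $M$ is a P-matrix, i.e. all of its principal minors are positive, then there is a point $x^*\in\mathbb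 R^n$ with $\mathtt{sol}(M,q)=\mathcal G_f=\{x^*\}$; in particular $x^*$ is the unique element of $\mathtt{sol}(M,q)$. -/

import Mathlib

open scoped Matrix

noncomputable section

namespace LCP

/-- The affine map `x ↦ M x + q`, as a family of coordinates `M_i x + q_i`. -/
def affine {n : ℕ} (M : Matrix (Fin n) (Fin n) ℝ) (q x : EuclideanSpace ℝ (Fin n))
    (i : Fin n) : ℝ :=
  (M *ᵥ x.ofLp) i + q i

/-- The feasible set `fea(M,q) = {x : x ≥ 0, M x + q ≥ 0}`. -/
def fea {n : ℕ} (M : Matrix (Fin n) (Fin n) ℝ) (q : EuclideanSpace ℝ (Fin n)) :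
    Set (EuclideanSpace ℝ (Fin n)) :=
  {x | (∀ i, 0 ≤ x i) ∧ ∀ i, 0 ≤ affine M q x i}

/-- The solution set `sol(M,q) = {x : x ≥ 0, M x + q ≥ 0, ⟨x, M x + q⟩ = 0}`. -/
def sol {n : ℕ} (M : Matrix (Fin n) (Fin n) ℝ) (q : EuclideanSpace ℝ (Fin n)) :
    Set (EuclideanSpace ℝ (Fin n)) :=
  {x | (∀ i, 0 ≤ x i) ∧ (∀ i, 0 ≤ affine M q x i) ∧ ∑ i, x i * affine M q x i = 0}

/-- `φ_r(a,b) = (1/r) (a₊^r b₊^r + (-a)₊^r + (-b)₊^r)`, where `t₊ = max t 0`. -/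
def phi (r a b : ℝ) : ℝ :=
  1 / r * (max a 0 ^ r * max b 0 ^ r + max (-a) 0 ^ r + max (-b) 0 ^ r)

/-- The merit function `f_r(x) = ∑ i, φ_r(x_i, M_i x + q_i)`. -/
def merit {n : ℕ} (r : ℝ) (M : Matrix (Fin n) (Fin n) ℝ) (q x : EuclideanSpace ℝ (Fin n)) : ℝ :=
  ∑ i, phi r (x i) (affine M q x i)

/-- The set of stationary points of `f_r`: the points at which `f_r` is (Fréchet) differentiable
with respect to the Euclidean structure, with gradient zero. -/
def stationary {n : ℕ} (r : ℝ) (M : Matrix (Fin n) (Fin n) ℝ) (q : EuclideanSpace ℝ (Fin n)) :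
    Set (EuclideanSpace ℝ (Fin n)) :=
  {x | HasGradientAt (merit r M q) 0 x}

/-- A real square matrix, not necessarily symmetric, is positive semidefinite if `xᵀ M x ≥ 0`
for all `x`. (`Matrix.PosSemidef` would in addition require symmetry.) -/
def IsPSD {n : ℕ} (M : Matrix (Fin n) (Fin n) ℝ) : Prop :=
  ∀ x : Fin n → ℝ, 0 ≤ x ⬝ᵥ (M *ᵥ x)

/-- A real square matrix is a P-matrix if all of its principal minors are positive. -/
def IsPMatrix {n : ℕ} (M : Matrix (Fin n) (Fin n) ℝ) : Prop :=
  ∀ T : Finset (Fin n), 0 < (M.submatrix (fun i : T => (i : Fin n)) (fun i : T => (i : Fin n))).det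

end LCP

end

/-!
The gradient of the merit function at `x` is `u + Mᵀ v`, where `uᵢ` and `vᵢ` are the two partial
derivatives of `phi r` at `(xᵢ, (M x + q)ᵢ)`. Always `uᵢ vᵢ ≥ 0`, and `uᵢ = vᵢ = 0` exactly when
`xᵢ` and `(M x + q)ᵢ` are nonnegative with product zero; so solutions are stationary, and the point
is to show that `u + Mᵀ v = 0` forces `u = v = 0`.

* If `M` is a P-matrix, then so is `Mᵀ`, and a P-matrix reverses the sign of no nonzero vector
  (`IsPMatrix.nonReversing`). Since `vᵢ (Mᵀ v)ᵢ = -uᵢ vᵢ ≤ 0`, it follows that `v = 0` and `u = 0`.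
* If `M` is positive semidefinite, then `0 ≤ ⟨v, Mᵀ v⟩ = -⟨u, v⟩ ≤ 0` gives `uᵢ vᵢ = 0`, so that
  `u, v ≤ 0`; pairing with a feasible point then yields `u = v = 0` (`IsPSD.sol_eq_stationary`).

Existence for a matrix that, like its transpose, reverses no sign (`NonReversing.sol_nonempty`): the
merit function is coercive, and its minimizer is stationary. For a feasible problem with `M` positive
semidefinite (`IsPSD.sol_nonempty`), this applies to `M + ε I` and gives solutions `x ε` with
`ε • x ε → 0`. They solve the problem for `M` and `q + ε • x ε`, and the set of those `q` for which
a solution exists is a finite union of finitely generated cones, hence closed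
(`isClosed_setOf_sol_nonempty`). Uniqueness for P-matrices is again the absence of sign reversal,
applied to the difference of two solutions.
-/

namespace LCP

/-! ### P-matrices and sign reversal -/

/-- The determinant of `diag(c) M + diag(d)`, expanded by row multilinearity into the principal
minors of `M`. -/
theorem det_of_smul_row_add_smul_one {n : ℕ} (M : Matrix (Fin n) (Fin n) ℝ) (c d : Fin n → ℝ) :
    (Matrix.of fun i => c i • M i + d i • (1 : Matrix (Fin n) (Fin n) ℝ) i).det =
      ∑ s : Finset (Fin n), (∏ i, if i ∈ s then c i else d i) *
        (M.submatrix (fun i : s => (i : Fin n)) (fun i : s => (i : Fin n))).det := by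
  let D := (Matrix.detRowAlternating : (Fin n → ℝ) [⋀^Fin n]→ₗ[ℝ] ℝ)
  change D ((fun i => c i • M i) + fun i => d i • (1 : Matrix (Fin n) (Fin n) ℝ) i) = _
  rw [D.map_add_univ]
  refine Finset.sum_congr rfl fun s _ => ?_
  have h : s.piecewise (fun i => c i • M i) (fun i => d i • (1 : Matrix (Fin n) (Fin n) ℝ) i) =
      fun i => (if i ∈ s then c i else d i) •
        s.piecewise M.row (1 : Matrix (Fin n) (Fin n) ℝ).row i := by
    funext i
    simp only [Finset.piecewise]
    split_ifs <;> rfl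
  rw [h, D.map_smul_univ, smul_eq_mul]
  congr 1
  exact Matrix.det_piecewise_one_eq_submatrix_det M s

/-- `M` reverses the sign of no nonzero vector: if `zᵢ (M z)ᵢ ≤ 0` for every `i`, then `z = 0`. By
the theorem of Fiedler and Pták this is equivalent to `M` being a P-matrix. It is the only form in
which the P-property is used, and it also holds for `M + ε I` when `M` is positive semidefinite. -/
def NonReversing {n : ℕ} (M : Matrix (Fin n) (Fin n) ℝ) : Prop :=
  ∀ z : Fin n → ℝ, (∀ i, z i * (M *ᵥ z) i ≤ 0) → z = 0

/-- If `z ≠ 0` and `zᵢ (M z)ᵢ ≤ 0` for all `i`, then `z` lies in the kernel of `diag(c) M + diag(d)`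
for suitable `c, d ≥ 0` with `c + d > 0`; but for a P-matrix `M` the determinant of such a matrix is
a sum of nonnegative terms of which at least one is positive. -/
theorem IsPMatrix.nonReversing {n : ℕ} {M : Matrix (Fin n) (Fin n) ℝ} (hM : IsPMatrix M) :
    NonReversing M := by
  intro z hz
  by_contra hne
  -- Then `cᵢ (M z)ᵢ + dᵢ zᵢ = 0` for every `i`.
  set c : Fin n → ℝ := fun i => if z i = 0 then 0 else 1 with hc
  set d : Fin n → ℝ := fun i => if z i = 0 then 1 else -(M *ᵥ z) i / z i with hd
  have hd0 : ∀ i, 0 ≤ d i := by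
    intro i
    by_cases h : z i = 0
    · simp [hd, h]
    · have h1 : -(M *ᵥ z) i / z i = -(z i * (M *ᵥ z) i) / (z i) ^ 2 := by field_simp
      have h2 := hz i
      simp only [hd, h, if_false, h1]
      apply div_nonneg _ (sq_nonneg _)
      linarith
  have hc0 : ∀ i, 0 ≤ c i := fun i => by
    simp only [hc]; split_ifs <;> norm_num
  have hker : (Matrix.of fun i => c i • M i + d i • (1 : Matrix (Fin n) (Fin n) ℝ) i) *ᵥ z = 0 := by
    funext i
    have h1 : ((Matrix.of fun i => c i • M i + d i • (1 : Matrix (Fin n) (Fin n) ℝ) i) *ᵥ z) i =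
        c i * (M *ᵥ z) i + d i * ((1 : Matrix (Fin n) (Fin n) ℝ) *ᵥ z) i := by
      simp only [Matrix.mulVec, Matrix.of_apply, add_dotProduct, smul_dotProduct, smul_eq_mul]
    rw [h1, Matrix.one_mulVec]
    by_cases h : z i = 0
    · simp [hc, h]
    · simp only [hc, hd, h, if_false, Pi.zero_apply]
      field_simp
      ring
  have hdet := Matrix.exists_mulVec_eq_zero_iff.mp ⟨z, hne, hker⟩
  rw [det_of_smul_row_add_smul_one] at hdet
  -- The positive term is the one indexed by the support of `z`.
  refine absurd hdet (ne_of_gt (Finset.sum_pos' (fun s _ => ?_)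
    ⟨Finset.univ.filter fun i => z i ≠ 0, Finset.mem_univ _, ?_⟩))
  · refine mul_nonneg (Finset.prod_nonneg fun i _ => ?_) (hM s).le
    split_ifs
    exacts [hc0 i, hd0 i]
  · refine mul_pos (Finset.prod_pos fun i _ => ?_) (hM _)
    by_cases h : z i = 0 <;> simp [hc, hd, h]

theorem IsPMatrix.transpose {n : ℕ} {M : Matrix (Fin n) (Fin n) ℝ} (hM : IsPMatrix M) :
    IsPMatrix Mᵀ := fun T => by
  have h := hM T
  rwa [← Matrix.det_transpose, Matrix.transpose_submatrix] at h

theorem IsPSD.transpose {n : ℕ} {M : Matrix (Fin n) (Fin n) ℝ} (hM : IsPSD M) :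
    IsPSD Mᵀ := fun x => by
  have h := hM x
  rwa [Matrix.mulVec_transpose, dotProduct_comm, ← Matrix.dotProduct_mulVec]

theorem IsPSD.nonReversing_add_smul_one {n : ℕ} {M : Matrix (Fin n) (Fin n) ℝ} (hM : IsPSD M)
    {ε : ℝ} (hε : 0 < ε) : NonReversing (M + ε • (1 : Matrix (Fin n) (Fin n) ℝ)) := by
  intro z hz
  have h1 : z ⬝ᵥ ((M + ε • (1 : Matrix (Fin n) (Fin n) ℝ)) *ᵥ z) ≤ 0 :=
    Finset.sum_nonpos fun i _ => hz i
  rw [Matrix.add_mulVec, Matrix.smul_mulVec, Matrix.one_mulVec, dotProduct_add, dotProduct_smul,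
    smul_eq_mul] at h1
  have h2 := hM z
  have h3 : 0 ≤ z ⬝ᵥ z := Finset.sum_nonneg fun i _ => mul_self_nonneg _
  exact dotProduct_self_eq_zero.mp (le_antisymm (by nlinarith) h3)

/-! ### Closedness of finitely generated cones -/

/-- The cone spanned by finitely many vectors is closed. If the vectors are independent, it is the
image of an orthant under a closed embedding; otherwise, as in Carathéodory's theorem, it is the
union of the cones spanned by one vector fewer. -/
theorem isClosed_setOf_nonneg_combination {E : Type*} [NormedAddCommGroup E] [NormedSpace ℝ E]
    {ι : Type*} [Fintype ι] (v : ι → E) (s : Finset ι) :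
    IsClosed {y | ∃ t : ι → ℝ, (∀ i, 0 ≤ t i) ∧ (∀ i ∉ s, t i = 0) ∧ ∑ i, t i • v i = y} := by
  classical
  induction s using Finset.strongInduction with
  | H s ih =>
    by_cases hinj : ∀ t : ι → ℝ, (∀ i ∉ s, t i = 0) → ∑ i, t i • v i = 0 → t = 0
    · let W : Submodule ℝ (ι → ℝ) :=
        { carrier := {t | ∀ i ∉ s, t i = 0}
          add_mem' := fun {a b} ha hb i hi => by simp [ha i hi, hb i hi]
          zero_mem' := fun i _ => rfl
          smul_mem' := fun c a ha i hi => by simp [ha i hi] }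
      let f : W →ₗ[ℝ] E := (Fintype.linearCombination ℝ v).comp W.subtype
      have hf : LinearMap.ker f = ⊥ := by
        rw [LinearMap.ker_eq_bot']
        intro t ht
        exact Subtype.ext (hinj t.1 t.2 (by simpa [f, Fintype.linearCombination_apply] using ht))
      have hcl : IsClosed {t : W | ∀ i, 0 ≤ t.1 i} := by
        simp only [Set.ofPred_forall]
        refine isClosed_iInter fun i => isClosed_le continuous_const ?_
        exact (continuous_apply i).comp continuous_subtype_val
      convert (LinearMap.isClosedEmbedding_of_injective hf).isClosedMap _ hcl using 1
      ext y
      constructor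
      · rintro ⟨t, h0, h1, h2⟩
        exact ⟨⟨t, h1⟩, h0, by simpa [f, Fintype.linearCombination_apply] using h2⟩
      · rintro ⟨t, h0, h2⟩
        exact ⟨t.1, h0, t.2, by simpa [f, Fintype.linearCombination_apply] using h2⟩
    · push Not at hinj
      obtain ⟨w, hws, hw, hne⟩ := hinj
      obtain ⟨z, hzs, hz, j, hj⟩ : ∃ z : ι → ℝ, (∀ i ∉ s, z i = 0) ∧ ∑ i, z i • v i = 0 ∧
          ∃ j, 0 < z j := by
        obtain ⟨j, hj⟩ := Function.ne_iff.mp hne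
        rcases lt_or_gt_of_ne hj with h | h
        · exact ⟨-w, fun i hi => by simp [hws i hi], by simp [hw], j, by simpa using h⟩
        · exact ⟨w, hws, hw, j, h⟩
      have hU : {y | ∃ t : ι → ℝ, (∀ i, 0 ≤ t i) ∧ (∀ i ∉ s, t i = 0) ∧ ∑ i, t i • v i = y} =
          ⋃ k ∈ s, {y | ∃ t : ι → ℝ, (∀ i, 0 ≤ t i) ∧ (∀ i ∉ s.erase k, t i = 0) ∧
            ∑ i, t i • v i = y} := by
        ext y
        simp only [Set.mem_iUnion, Set.mem_ofPred_eq, exists_prop]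
        constructor
        · rintro ⟨t, h0, h1, h2⟩
          obtain ⟨k, hk, hmin⟩ := Finset.exists_min_image
            (Finset.univ.filter fun i => 0 < z i) (fun i => t i / z i) ⟨j, by simpa using hj⟩
          simp only [Finset.mem_filter, Finset.mem_univ, true_and] at hk hmin
          -- Moving from `t` along `-z` until a coordinate vanishes keeps all coordinates nonnegative.
          refine ⟨k, by_contra fun h => hk.ne' (hzs k h), fun i => t i - t k / z k * z i, ?_, ?_, ?_⟩
          · intro i
            rcases lt_or_ge 0 (z i) with hi | hi
            · have := (le_div_iff₀ hi).mp (hmin i hi)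
              linarith
            · have h3 : 0 ≤ t k / z k := div_nonneg (h0 k) hk.le
              have := mul_nonpos_of_nonneg_of_nonpos h3 hi
              have := h0 i
              linarith
          · intro i hi
            by_cases hik : i = k
            · subst hik
              field_simp
              ring
            · have his : i ∉ s := fun h => hi (Finset.mem_erase.mpr ⟨hik, h⟩)
              simp [h1 i his, hzs i his]
          · simp_rw [sub_smul, mul_smul, Finset.sum_sub_distrib, ← Finset.smul_sum]
            rw [hz, h2]; simp
        · rintro ⟨k, _, t, h0, h1, h2⟩
          exact ⟨t, h0, fun i hi => h1 i fun h => hi (Finset.mem_of_mem_erase h), h2⟩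
      rw [hU]
      exact isClosed_biUnion_finset fun k hk => ih _ (Finset.erase_ssubset hk)

/-! ### The gradient of the merit function -/

theorem hasDerivAt_max_zero_rpow {r : ℝ} (hr : 2 ≤ r) (t : ℝ) :
    HasDerivAt (fun s : ℝ => max s 0 ^ r) (r * max t 0 ^ (r - 1)) t := by
  have hpow : ∀ t : ℝ, HasDerivAt (fun s : ℝ => s ^ r) (r * t ^ (r - 1)) t := fun t =>
    Real.hasDerivAt_rpow_const (Or.inr (by linarith))
  have h0 : (0 : ℝ) ^ r = 0 := Real.zero_rpow (by linarith)
  have h1 : (0 : ℝ) ^ (r - 1) = 0 := Real.zero_rpow (by linarith)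
  rcases lt_trichotomy t 0 with ht | rfl | ht
  · rw [max_eq_right ht.le, h1, mul_zero]
    refine (hasDerivAt_const t (0 : ℝ)).congr_of_eventuallyEq ?_
    filter_upwards [gt_mem_nhds ht] with s hs
    rw [max_eq_right hs.le, h0]
  · have hl : HasDerivWithinAt (fun s : ℝ => max s 0 ^ r) 0 (Set.Iic 0) 0 :=
      (hasDerivWithinAt_const (0 : ℝ) (Set.Iic 0) (0 : ℝ)).congr
        (fun s hs => by rw [max_eq_right hs, h0]) (by simp [h0])
    have hu : HasDerivWithinAt (fun s : ℝ => max s 0 ^ r) 0 (Set.Ici 0) 0 := by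
      have h := (hpow 0).hasDerivWithinAt (s := Set.Ici 0)
      rw [h1, mul_zero] at h
      exact h.congr (fun s hs => by rw [max_eq_left hs]) (by simp)
    rw [max_self, h1, mul_zero]
    have h := hl.union hu
    rwa [Set.Iic_union_Ici, hasDerivWithinAt_univ] at h
  · rw [max_eq_left ht.le]
    refine (hpow t).congr_of_eventuallyEq ?_
    filter_upwards [lt_mem_nhds ht] with s hs
    rw [max_eq_left hs.le]

/-- The partial derivative of `phi r` in its first argument, at `(a, b)`. As `phi r` is symmetric, its
partial derivative in the second argument is `dphi r b a`. -/
noncomputable def dphi (r a b : ℝ) : ℝ := max a 0 ^ (r - 1) * max b 0 ^ r - max (-a) 0 ^ (r - 1)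

theorem hasFDerivAt_phi {E : Type*} [NormedAddCommGroup E] [NormedSpace ℝ E] {r : ℝ} (hr : 2 ≤ r)
    {A B : E → ℝ} {A' B' : E →L[ℝ] ℝ} {x : E} (hA : HasFDerivAt A A' x) (hB : HasFDerivAt B B' x) :
    HasFDerivAt (fun y => phi r (A y) (B y))
      (dphi r (A x) (B x) • A' + dphi r (B x) (A x) • B') x := by
  have hr0 : r ≠ 0 := by linarith
  have h1 := (hasDerivAt_max_zero_rpow hr (A x)).comp_hasFDerivAt x hA
  have h2 := (hasDerivAt_max_zero_rpow hr (B x)).comp_hasFDerivAt x hB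
  have h3 := (hasDerivAt_max_zero_rpow hr (-A x)).comp_hasFDerivAt x hA.neg
  have h4 := (hasDerivAt_max_zero_rpow hr (-B x)).comp_hasFDerivAt x hB.neg
  refine ((((h1.mul h2).add h3).add h4).const_mul (1 / r)).congr_fderiv ?_
  ext v
  simp [dphi]
  field_simp
  ring

theorem hasFDerivAt_affine {n : ℕ} (M : Matrix (Fin n) (Fin n) ℝ) (q x : EuclideanSpace ℝ (Fin n))
    (i : Fin n) : HasFDerivAt (fun y => affine M q y i)
      (∑ j, M i j • (EuclideanSpace.proj j : EuclideanSpace ℝ (Fin n) →L[ℝ] ℝ)) x := by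
  have h := ((∑ j, M i j • (EuclideanSpace.proj j : EuclideanSpace ℝ (Fin n) →L[ℝ] ℝ)).hasFDerivAt
    (x := x)).add_const (q i)
  refine h.congr_of_eventuallyEq (Filter.Eventually.of_forall fun y => ?_)
  simp [affine, Matrix.mulVec, dotProduct]

/-- The gradient of `merit r M q` at `x` is `u + Mᵀ v`, where `u` and `v` collect the partial
derivatives of `phi r` at `(xᵢ, (M x + q)ᵢ)`. -/
theorem hasGradientAt_merit {n : ℕ} {r : ℝ} (hr : 2 ≤ r) (M : Matrix (Fin n) (Fin n) ℝ)
    (q x : EuclideanSpace ℝ (Fin n)) :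
    HasGradientAt (merit r M q)
      (WithLp.toLp 2 ((fun i => dphi r (x i) (affine M q x i)) +
        Mᵀ *ᵥ fun i => dphi r (affine M q x i) (x i))) x := by
  rw [hasGradientAt_iff_hasFDerivAt]
  have h := HasFDerivAt.fun_sum (u := Finset.univ) fun i _ => hasFDerivAt_phi hr
    (EuclideanSpace.proj i : EuclideanSpace ℝ (Fin n) →L[ℝ] ℝ).hasFDerivAt
    (hasFDerivAt_affine M q x i)
  refine h.congr_fderiv ?_
  ext v
  simp only [PiLp.proj_apply, _root_.sum_apply, _root_.add_apply,
    _root_.smul_apply, smul_eq_mul, InnerProductSpace.toDual_apply_apply,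
    PiLp.inner_apply, Pi.add_apply, Matrix.mulVec, dotProduct, Matrix.transpose_apply,
    RCLike.inner_apply, conj_trivial, mul_add, Finset.sum_add_distrib]
  congr 1
  · exact Finset.sum_congr rfl fun i _ => mul_comm _ _
  · simp_rw [Finset.mul_sum]
    rw [Finset.sum_comm]
    exact Finset.sum_congr rfl fun i _ => Finset.sum_congr rfl fun j _ => by ring

theorem mem_stationary_iff {n : ℕ} {r : ℝ} (hr : 2 ≤ r) (M : Matrix (Fin n) (Fin n) ℝ)
    (q x : EuclideanSpace ℝ (Fin n)) :
    x ∈ stationary r M q ↔ (fun i => dphi r (x i) (affine M q x i)) +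
        Mᵀ *ᵥ (fun i => dphi r (affine M q x i) (x i)) = 0 := by
  have h := hasGradientAt_merit hr M q x
  constructor
  · intro hx
    exact (WithLp.toLp_eq_zero 2).mp (h.unique hx)
  · intro h0
    rw [h0] at h
    simpa [stationary] using h

/-! ### Signs of the partial derivatives -/

theorem dphi_of_nonpos_left {r a b : ℝ} (hr : 2 ≤ r) (ha : a ≤ 0) :
    dphi r a b = -(-a) ^ (r - 1) := by
  rw [dphi, max_eq_right ha, max_eq_left (neg_nonneg.mpr ha), Real.zero_rpow (by linarith)]
  ring

theorem dphi_of_nonneg_left {r a b : ℝ} (hr : 2 ≤ r) (ha : 0 ≤ a) :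
    dphi r a b = a ^ (r - 1) * max b 0 ^ r := by
  rw [dphi, max_eq_left ha, max_eq_right (neg_nonpos.mpr ha), Real.zero_rpow (by linarith)]
  ring

theorem dphi_of_nonneg_of_nonpos {r a b : ℝ} (hr : 2 ≤ r) (ha : 0 ≤ a) (hb : b ≤ 0) :
    dphi r a b = 0 := by
  rw [dphi_of_nonneg_left hr ha, max_eq_right hb, Real.zero_rpow (by linarith), mul_zero]

theorem dphi_neg {r a b : ℝ} (hr : 2 ≤ r) (ha : a < 0) : dphi r a b < 0 := by
  rw [dphi_of_nonpos_left hr ha.le, neg_lt_zero]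
  exact Real.rpow_pos_of_pos (neg_pos.mpr ha) _

theorem dphi_pos {r a b : ℝ} (hr : 2 ≤ r) (ha : 0 < a) (hb : 0 < b) : 0 < dphi r a b := by
  rw [dphi_of_nonneg_left hr ha.le, max_eq_left hb.le]
  exact mul_pos (Real.rpow_pos_of_pos ha _) (Real.rpow_pos_of_pos hb _)

theorem dphi_nonpos {r a b : ℝ} (hr : 2 ≤ r) (hab : a ≤ 0 ∨ b ≤ 0) : dphi r a b ≤ 0 := by
  rcases lt_or_ge 0 a with ha | ha
  · exact (dphi_of_nonneg_of_nonpos hr ha.le (hab.resolve_left ha.not_ge)).le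
  · rw [dphi_of_nonpos_left hr ha, neg_nonpos]
    exact Real.rpow_nonneg (neg_nonneg.mpr ha) _

theorem dphi_mul_dphi_nonneg {r : ℝ} (hr : 2 ≤ r) (a b : ℝ) : 0 ≤ dphi r a b * dphi r b a := by
  by_cases h : a ≤ 0 ∨ b ≤ 0
  · exact mul_nonneg_of_nonpos_of_nonpos (dphi_nonpos hr h) (dphi_nonpos hr h.symm)
  · push Not at h
    exact (mul_pos (dphi_pos hr h.1 h.2) (dphi_pos hr h.2 h.1)).le

theorem dphi_eq_zero_iff {r : ℝ} (hr : 2 ≤ r) {a b : ℝ} :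
    (dphi r a b = 0 ∧ dphi r b a = 0) ↔ 0 ≤ a ∧ 0 ≤ b ∧ a * b = 0 := by
  constructor
  · rintro ⟨h1, h2⟩
    have ha : 0 ≤ a := not_lt.mp fun h => (dphi_neg hr h).ne h1
    have hb : 0 ≤ b := not_lt.mp fun h => (dphi_neg hr h).ne h2
    refine ⟨ha, hb, by_contra fun h => ?_⟩
    rw [mul_eq_zero, not_or] at h
    exact (dphi_pos hr (ha.lt_of_ne' h.1) (hb.lt_of_ne' h.2)).ne' h1
  · have key : ∀ c : ℝ, 0 ≤ c → dphi r 0 c = 0 ∧ dphi r c 0 = 0 := fun c hc =>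
      ⟨by rw [dphi_of_nonneg_left hr le_rfl, Real.zero_rpow (by linarith), zero_mul],
        dphi_of_nonneg_of_nonpos hr hc le_rfl⟩
    rintro ⟨ha, hb, hab⟩
    rcases mul_eq_zero.mp hab with rfl | rfl
    · exact key b hb
    · exact (key a ha).symm

theorem dphi_mul_nonneg {r a b : ℝ} (hr : 2 ≤ r) (hab : a ≤ 0 ∨ b ≤ 0) : 0 ≤ dphi r a b * a := by
  rcases lt_or_ge 0 a with ha | ha
  · rw [dphi_of_nonneg_of_nonpos hr ha.le (hab.resolve_left ha.not_ge), zero_mul]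
  · exact mul_nonneg_of_nonpos_of_nonpos (dphi_nonpos hr hab) ha

/-! ### Stationary points and solutions -/

theorem mem_sol_iff {n : ℕ} (M : Matrix (Fin n) (Fin n) ℝ) (q x : EuclideanSpace ℝ (Fin n)) :
    x ∈ sol M q ↔ ∀ i, 0 ≤ x i ∧ 0 ≤ affine M q x i ∧ x i * affine M q x i = 0 := by
  constructor
  · rintro ⟨h1, h2, h3⟩ i
    exact ⟨h1 i, h2 i, (Finset.sum_eq_zero_iff_of_nonneg fun i _ =>
      mul_nonneg (h1 i) (h2 i)).mp h3 i (Finset.mem_univ i)⟩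
  · intro h
    exact ⟨fun i => (h i).1, fun i => (h i).2.1, Finset.sum_eq_zero fun i _ => (h i).2.2⟩

theorem mem_sol_iff_dphi {n : ℕ} {r : ℝ} (hr : 2 ≤ r) (M : Matrix (Fin n) (Fin n) ℝ)
    (q x : EuclideanSpace ℝ (Fin n)) :
    x ∈ sol M q ↔ (fun i => dphi r (x i) (affine M q x i)) = 0 ∧
      (fun i => dphi r (affine M q x i) (x i)) = 0 := by
  simp only [mem_sol_iff, ← dphi_eq_zero_iff hr, forall_and, funext_iff, Pi.zero_apply]

theorem sol_subset_stationary {n : ℕ} {r : ℝ} (hr : 2 ≤ r) (M : Matrix (Fin n) (Fin n) ℝ)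
    (q : EuclideanSpace ℝ (Fin n)) : sol M q ⊆ stationary r M q := by
  intro x hx
  obtain ⟨h1, h2⟩ := (mem_sol_iff_dphi hr M q x).mp hx
  rw [mem_stationary_iff hr, h1, h2, Matrix.mulVec_zero, add_zero]

/-- At a stationary point `u + Mᵀ v = 0`, so `vᵢ (Mᵀ v)ᵢ = -uᵢ vᵢ ≤ 0` for every `i`, which forces
`v = 0` and then `u = 0`. -/
theorem NonReversing.sol_eq_stationary {n : ℕ} {r : ℝ} (hr : 2 ≤ r)
    {M : Matrix (Fin n) (Fin n) ℝ} (hM : NonReversing Mᵀ) (q : EuclideanSpace ℝ (Fin n)) :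
    sol M q = stationary r M q := by
  refine (sol_subset_stationary hr M q).antisymm fun x hx => ?_
  rw [mem_stationary_iff hr] at hx
  have hv := hM (fun i => dphi r (affine M q x i) (x i)) fun i => by
    have h := congrFun hx i
    simp only [Pi.add_apply, Pi.zero_apply] at h
    rw [eq_neg_of_add_eq_zero_right h, mul_neg, neg_nonpos]
    exact dphi_mul_dphi_nonneg hr _ _
  rw [hv, Matrix.mulVec_zero, add_zero] at hx
  exact (mem_sol_iff_dphi hr M q x).mpr ⟨hx, hv⟩

/-- At a stationary point `u + Mᵀ v = 0`, and positive semidefiniteness forces `uᵢ vᵢ = 0`. Hence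
`u, v ≤ 0`, and `-v` would be a Farkas certificate of infeasibility unless `x` is feasible: this is
seen by comparing `⟨v, q⟩` at `x` and at a feasible point `w`. -/
theorem IsPSD.sol_eq_stationary {n : ℕ} {r : ℝ} (hr : 2 ≤ r)
    {M : Matrix (Fin n) (Fin n) ℝ} (hM : IsPSD M) {q : EuclideanSpace ℝ (Fin n)}
    (hfea : (fea M q).Nonempty) : sol M q = stationary r M q := by
  refine (sol_subset_stationary hr M q).antisymm fun x hx => ?_
  rw [mem_stationary_iff hr] at hx
  obtain ⟨w, hw, hMw⟩ := hfea
  set u : Fin n → ℝ := fun i => dphi r (x i) (affine M q x i) with hu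
  set v : Fin n → ℝ := fun i => dphi r (affine M q x i) (x i) with hv
  have huv0 : ∀ i, 0 ≤ u i * v i := fun i => dphi_mul_dphi_nonneg hr _ _
  have hMv : Mᵀ *ᵥ v = -u := eq_neg_of_add_eq_zero_right hx
  have hpair : ∀ y : Fin n → ℝ, v ⬝ᵥ (M *ᵥ y) = -∑ i, u i * y i := fun y => by
    rw [Matrix.dotProduct_mulVec, ← Matrix.mulVec_transpose, hMv, neg_dotProduct]; rfl
  have huv : ∀ i, u i * v i = 0 := by
    have h := hM v
    rw [hpair v] at h
    have h0 : ∑ i, u i * v i = 0 :=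
      le_antisymm (by linarith) (Finset.sum_nonneg fun i _ => huv0 i)
    exact fun i => (Finset.sum_eq_zero_iff_of_nonneg fun i _ => huv0 i).mp h0 i (Finset.mem_univ i)
  have hsign : ∀ i, x i ≤ 0 ∨ affine M q x i ≤ 0 := fun i => by
    by_contra! h
    exact (mul_pos (dphi_pos hr h.1 h.2) (dphi_pos hr h.2 h.1)).ne' (huv i)
  -- By stationarity, `⟨v, M y + q⟩ + ⟨u, y⟩` does not depend on `y`. It is nonpositive at `y = w` and
  -- a sum of nonnegative terms at `y = x`.
  have hdiff : ∀ y : EuclideanSpace ℝ (Fin n),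
      ∑ i, v i * affine M q y i + ∑ i, u i * y i = ∑ i, v i * q i := fun y => by
    have h : ∑ i, v i * (M *ᵥ y.ofLp) i = -∑ i, u i * y i := hpair y.ofLp
    simp only [affine, mul_add, Finset.sum_add_distrib, h]
    ring
  have hux : ∀ i, 0 ≤ u i * x i := fun i => dphi_mul_nonneg hr (hsign i)
  have hvx : ∀ i, 0 ≤ v i * affine M q x i := fun i => dphi_mul_nonneg hr (hsign i).symm
  have hw1 : ∑ i, v i * affine M q w i ≤ 0 := Finset.sum_nonpos fun i _ =>
    mul_nonpos_of_nonpos_of_nonneg (dphi_nonpos hr (hsign i).symm) (hMw i)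
  have hw2 : ∑ i, u i * w i ≤ 0 := Finset.sum_nonpos fun i _ =>
    mul_nonpos_of_nonpos_of_nonneg (dphi_nonpos hr (hsign i)) (hw i)
  have hx1 : 0 ≤ ∑ i, u i * x i := Finset.sum_nonneg fun i _ => hux i
  have hx2 : 0 ≤ ∑ i, v i * affine M q x i := Finset.sum_nonneg fun i _ => hvx i
  have hxw := (hdiff x).trans (hdiff w).symm
  have hux0 : ∑ i, u i * x i = 0 := by linarith
  have hvx0 : ∑ i, v i * affine M q x i = 0 := by linarith
  rw [Finset.sum_eq_zero_iff_of_nonneg fun i _ => hux i] at hux0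
  rw [Finset.sum_eq_zero_iff_of_nonneg fun i _ => hvx i] at hvx0
  have hnn : ∀ {a b : ℝ}, dphi r a b * a = 0 → 0 ≤ a := fun {a b} h => by
    by_contra! ha
    exact (mul_pos_of_neg_of_neg (dphi_neg hr ha) ha).ne' h
  refine (mem_sol_iff M q x).mpr fun i => ?_
  have h1 : 0 ≤ x i := hnn (hux0 i (Finset.mem_univ i))
  have h2 : 0 ≤ affine M q x i := hnn (hvx0 i (Finset.mem_univ i))
  refine ⟨h1, h2, ?_⟩
  rcases hsign i with h | h
  · rw [le_antisymm h h1, zero_mul]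
  · rw [le_antisymm h h2, mul_zero]

/-! ### Existence and uniqueness for matrices that reverse no sign -/

theorem mul_phi {r : ℝ} (hr : 2 ≤ r) (a b : ℝ) :
    r * phi r a b = max a 0 ^ r * max b 0 ^ r + max (-a) 0 ^ r + max (-b) 0 ^ r := by
  have : r ≠ 0 := by linarith
  rw [phi]
  field_simp

/-- The merit function dominates the natural residual `min a b`, up to an additive constant. -/
theorem abs_min_le_one_add_phi {r : ℝ} (hr : 2 ≤ r) (a b : ℝ) :
    |min a b| ≤ 1 + r * phi r a b := by
  rw [mul_phi hr]
  have hnn : ∀ t : ℝ, 0 ≤ max t 0 ^ r := fun t => Real.rpow_nonneg (le_max_right _ _) _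
  have hself : ∀ t : ℝ, t ≤ 1 + max t 0 ^ r := fun t => by
    rcases le_total t 1 with h | h
    · linarith [hnn t]
    · rw [max_eq_left (by linarith)]
      linarith [Real.self_le_rpow_of_one_le h (by linarith : (1 : ℝ) ≤ r)]
  have hab := mul_nonneg (hnn a) (hnn b)
  refine abs_le.mpr ⟨?_, ?_⟩
  · rw [neg_le]
    rcases min_choice a b with h | h <;> rw [h]
    · linarith [hself (-a), hnn (-b)]
    · linarith [hself (-b), hnn (-a)]
  · rcases le_total (min a b) 1 with h | h
    · linarith [hnn (-a), hnn (-b)]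
    · have ha : 1 ≤ a := h.trans (min_le_left _ _)
      have hb : 1 ≤ b := h.trans (min_le_right _ _)
      have h1 := Real.self_le_rpow_of_one_le ha (by linarith : (1 : ℝ) ≤ r)
      have h2 := Real.one_le_rpow hb (by linarith : (0 : ℝ) ≤ r)
      have h3 := hnn (-a)
      have h4 := hnn (-b)
      have h5 := min_le_left a b
      rw [max_eq_left (by linarith : (0 : ℝ) ≤ a), max_eq_left (by linarith : (0 : ℝ) ≤ b)]
      nlinarith

/-- The residual `∑ |min(xᵢ, (M x)ᵢ)|` is positively homogeneous, and it vanishes only at `0`: where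
`min(xᵢ, (M x)ᵢ) = 0`, one of the two numbers is zero and so is their product. -/
theorem NonReversing.exists_mul_norm_le {n : ℕ} {M : Matrix (Fin n) (Fin n) ℝ}
    (hM : NonReversing M) :
    ∃ c : ℝ, 0 < c ∧ ∀ x : EuclideanSpace ℝ (Fin n),
      c * ‖x‖ ≤ ∑ i, |min (x i) ((M *ᵥ x.ofLp) i)| := by
  have hcont : Continuous fun x : EuclideanSpace ℝ (Fin n) =>
      ∑ i, |min (x i) ((M *ᵥ x.ofLp) i)| := by
    simp only [Matrix.mulVec, dotProduct]
    fun_prop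
  obtain ⟨c, hc, hle⟩ := (isCompact_sphere (0 : EuclideanSpace ℝ (Fin n)) 1).exists_forall_le'
    hcont.continuousOn (a := 0) fun x hx => by
      refine (Finset.sum_nonneg fun i _ => abs_nonneg _).lt_of_ne' fun h => ?_
      rw [Finset.sum_eq_zero_iff_of_nonneg fun i _ => abs_nonneg _] at h
      have hx0 : x.ofLp = 0 := hM _ fun i => by
        have h1 := abs_eq_zero.mp (h i (Finset.mem_univ i))
        rcases min_choice (x i) ((M *ᵥ x.ofLp) i) with h2 | h2 <;> rw [h1] at h2 <;> simp [← h2]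
      rw [(WithLp.ofLp_eq_zero 2).mp hx0] at hx
      simp at hx
  refine ⟨c, hc, fun x => ?_⟩
  rcases eq_or_ne x 0 with rfl | hx
  · simp
  have hpos : 0 < ‖x‖ := norm_pos_iff.mpr hx
  have h := hle (‖x‖⁻¹ • x) (by simp [norm_smul, hpos.ne'])
  have h1 : ∀ i, |min ((‖x‖⁻¹ • x) i) ((M *ᵥ (‖x‖⁻¹ • x).ofLp) i)| =
      ‖x‖⁻¹ * |min (x i) ((M *ᵥ x.ofLp) i)| := fun i => by
    rw [WithLp.ofLp_smul, Matrix.mulVec_smul, Pi.smul_apply, Pi.smul_apply, smul_eq_mul,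
      smul_eq_mul, ← mul_min_of_nonneg _ _ (inv_nonneg.mpr hpos.le), abs_mul,
      abs_of_nonneg (inv_nonneg.mpr hpos.le)]
  simp_rw [h1, ← Finset.mul_sum] at h
  rwa [inv_mul_eq_div, le_div_iff₀ hpos] at h

theorem NonReversing.isBounded_setOf_merit_le {n : ℕ} {r : ℝ} (hr : 2 ≤ r)
    {M : Matrix (Fin n) (Fin n) ℝ} (hM : NonReversing M) (q : EuclideanSpace ℝ (Fin n)) (C : ℝ) :
    Bornology.IsBounded {x | merit r M q x ≤ C} := by
  obtain ⟨c, hc, hle⟩ := hM.exists_mul_norm_le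
  refine isBounded_iff_forall_norm_le.mpr ⟨((n + r * C) + ∑ i, |q i|) / c, fun x hx => ?_⟩
  rw [le_div_iff₀ hc, mul_comm]
  refine (hle x).trans ?_
  have h : ∀ i, |min (x i) ((M *ᵥ x.ofLp) i)| ≤ (1 + r * phi r (x i) (affine M q x i)) + |q i| :=
    fun i => by
      have h1 := abs_min_sub_min_le_max (x i) ((M *ᵥ x.ofLp) i) (x i) (affine M q x i)
      have h2 : (M *ᵥ x.ofLp) i - affine M q x i = -q i := by rw [affine]; ring
      rw [h2, sub_self, abs_zero, abs_neg, max_eq_right (abs_nonneg _)] at h1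
      linarith [abs_sub_abs_le_abs_sub (min (x i) ((M *ᵥ x.ofLp) i))
        (min (x i) (affine M q x i)), abs_min_le_one_add_phi hr (x i) (affine M q x i)]
  refine (Finset.sum_le_sum fun i _ => h i).trans ?_
  simp only [Finset.sum_add_distrib, ← Finset.mul_sum, Finset.sum_const, Finset.card_univ,
    Fintype.card_fin, nsmul_eq_mul, mul_one]
  have : r * merit r M q x ≤ r * C := mul_le_mul_of_nonneg_left hx (by linarith)
  rw [merit] at this
  linarith

/-- The merit function with exponent `2` is coercive; its minimizer is a stationary point, hence a
solution. -/
theorem NonReversing.sol_nonempty {n : ℕ} {M : Matrix (Fin n) (Fin n) ℝ} (hM : NonReversing M)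
    (hMt : NonReversing Mᵀ) (q : EuclideanSpace ℝ (Fin n)) : (sol M q).Nonempty := by
  have hcont : Continuous (merit 2 M q) := continuous_iff_continuousAt.mpr fun x =>
    (hasGradientAt_merit le_rfl M q x).continuousAt
  obtain ⟨x, hx⟩ := hcont.exists_forall_le_of_isBounded 0
    (hM.isBounded_setOf_merit_le le_rfl q _)
  refine ⟨x, ?_⟩
  rw [hMt.sol_eq_stationary le_rfl]
  have hg := hasGradientAt_merit le_rfl M q x
  have h0 := (isMinOn_univ_iff.mpr hx).isLocalMin Filter.univ_mem |>.hasFDerivAt_eq_zero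
    hg.hasFDerivAt
  rw [stationary, Set.mem_ofPred_eq, hasGradientAt_iff_hasFDerivAt, map_zero, ← h0]
  exact hg.hasFDerivAt

theorem NonReversing.sol_subsingleton {n : ℕ} {M : Matrix (Fin n) (Fin n) ℝ} (hM : NonReversing M)
    (q : EuclideanSpace ℝ (Fin n)) : (sol M q).Subsingleton := by
  intro x hx y hy
  rw [mem_sol_iff] at hx hy
  have h : x.ofLp - y.ofLp = 0 := hM _ fun i => by
    have h1 : (M *ᵥ (x.ofLp - y.ofLp)) i = affine M q x i - affine M q y i := by
      rw [Matrix.mulVec_sub, Pi.sub_apply, affine, affine]; ring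
    rw [h1, Pi.sub_apply]
    obtain ⟨a1, a2, a3⟩ := hx i
    obtain ⟨b1, b2, b3⟩ := hy i
    nlinarith [mul_nonneg a1 b2, mul_nonneg b1 a2]
  exact WithLp.ofLp_injective 2 (sub_eq_zero.mp h)

/-! ### Existence for positive semidefinite matrices -/

/-- The vectors `q` for which the linear complementarity problem is solvable form the union of the
finitely many complementary cones of `M`, each spanned by `-M eᵢ` for `i ∈ s` and `eᵢ` for `i ∉ s`. -/
theorem isClosed_setOf_sol_nonempty {n : ℕ} (M : Matrix (Fin n) (Fin n) ℝ) :
    IsClosed {q : EuclideanSpace ℝ (Fin n) | (sol M q).Nonempty} := by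
  classical
  let v : Finset (Fin n) → Fin n → EuclideanSpace ℝ (Fin n) := fun s i =>
    if i ∈ s then -WithLp.toLp 2 (M.col i) else EuclideanSpace.single i 1
  have hsum : ∀ (s : Finset (Fin n)) (t : Fin n → ℝ) (j : Fin n), (∑ i, t i • v s i) j =
      (if j ∈ s then 0 else t j) - (M *ᵥ fun i => if i ∈ s then t i else 0) j := by
    intro s t j
    have h : ∀ i, (t i • v s i) j =
        (if i = j then if j ∈ s then 0 else t j else 0) - M j i * if i ∈ s then t i else 0 := by
      intro i
      by_cases hij : i = j
      · subst hij
        by_cases hi : i ∈ s <;> simp [v, hi, mul_comm]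
      · by_cases hi : i ∈ s <;> simp [v, hi, mul_comm, hij, Ne.symm hij]
    rw [WithLp.ofLp_sum, Finset.sum_apply]
    simp_rw [h]
    simp [Matrix.mulVec, dotProduct]
  have hU : {q : EuclideanSpace ℝ (Fin n) | (sol M q).Nonempty} = ⋃ s : Finset (Fin n),
      {y | ∃ t : Fin n → ℝ, (∀ i, 0 ≤ t i) ∧ (∀ i ∉ Finset.univ, t i = 0) ∧
        ∑ i, t i • v s i = y} := by
    ext q
    simp only [Set.mem_iUnion, Set.mem_ofPred_eq, Finset.mem_univ, not_true, false_imp_iff,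
      implies_true, true_and]
    constructor
    · rintro ⟨x, hx⟩
      rw [mem_sol_iff] at hx
      refine ⟨Finset.univ.filter fun i => affine M q x i = 0,
        fun i => if affine M q x i = 0 then x i else affine M q x i, fun i => ?_, ?_⟩
      · obtain ⟨h1, h2, -⟩ := hx i
        dsimp only
        split_ifs <;> assumption
      · ext j
        have hx' : (fun i => if affine M q x i = 0 then x i else 0) = x.ofLp := by
          funext i
          split_ifs with h
          · rfl
          · exact ((mul_eq_zero.mp (hx i).2.2).resolve_right h).symm
        rw [hsum]
        have h1 : (fun i => if i ∈ Finset.univ.filter (fun i => affine M q x i = 0) then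
            (if affine M q x i = 0 then x i else affine M q x i) else 0) = x.ofLp := by
          rw [← hx']
          funext i
          by_cases h : affine M q x i = 0 <;> simp [h]
        have h2 : (if j ∈ Finset.univ.filter (fun i => affine M q x i = 0) then (0 : ℝ) else
            (if affine M q x j = 0 then x j else affine M q x j)) = affine M q x j := by
          by_cases h : affine M q x j = 0 <;> simp [h]
        rw [h1, h2, affine]
        ring
    · rintro ⟨s, t, ht, rfl⟩
      refine ⟨WithLp.toLp 2 fun i => if i ∈ s then t i else 0, (mem_sol_iff _ _ _).mpr fun i => ?_⟩
      have h : affine M (∑ i, t i • v s i) (WithLp.toLp 2 fun i => if i ∈ s then t i else 0) i =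
          if i ∈ s then 0 else t i := by
        rw [affine, hsum]
        ring
      rw [h]
      have := ht i
      by_cases hi : i ∈ s <;> simp [hi, this]
  rw [hU]
  exact isClosed_iUnion_of_finite fun s => isClosed_setOf_nonneg_combination (v s) _

/-- A feasible monotone linear complementarity problem is solvable. The problem for `M + ε I` has a
solution `x ε`, which also solves the problem for `M` with `q` replaced by `q + ε • x ε`. By
feasibility `ε • x ε → 0`, although `x ε` itself is not known to stay bounded, and the set of vectors
`q` with a solvable problem is closed. -/
theorem IsPSD.sol_nonempty {n : ℕ} {M : Matrix (Fin n) (Fin n) ℝ} (hM : IsPSD M)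
    {q : EuclideanSpace ℝ (Fin n)} (hfea : (fea M q).Nonempty) : (sol M q).Nonempty := by
  obtain ⟨w, hw, hMw⟩ := hfea
  have hex : ∀ ε : ℝ, 0 < ε → ∃ x : EuclideanSpace ℝ (Fin n),
      x ∈ sol (M + ε • (1 : Matrix (Fin n) (Fin n) ℝ)) q := fun ε hε => by
    refine (hM.nonReversing_add_smul_one hε).sol_nonempty ?_ q
    rw [Matrix.transpose_add, Matrix.transpose_smul, Matrix.transpose_one]
    exact hM.transpose.nonReversing_add_smul_one hε
  choose! x hx using hex
  have haff : ∀ ε i, affine (M + ε • (1 : Matrix (Fin n) (Fin n) ℝ)) q (x ε) i =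
      affine M (q + ε • x ε) (x ε) i := fun ε i => by
    simp [affine, Matrix.add_mulVec, Matrix.smul_mulVec]
    ring
  have hmem : ∀ ε, 0 < ε → (sol M (q + ε • x ε)).Nonempty := fun ε hε => by
    refine ⟨x ε, ?_⟩
    have h := hx ε hε
    simp only [mem_sol_iff, haff] at h ⊢
    exact h
  set C : ℝ := ∑ i, w i * affine M q w i with hC
  have hbound : ∀ ε, 0 < ε → ‖ε • x ε‖ ^ 2 ≤ ε * (‖ε • x ε‖ * ‖w‖ + C) := fun ε hε => by
    have hs := hx ε hε
    simp only [mem_sol_iff, haff] at hs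
    -- Monotonicity, applied to the difference of `x ε` and the feasible point `w`.
    have hpsd := hM ((x ε).ofLp - w.ofLp)
    have h1 : ∀ i, ((x ε).ofLp - w.ofLp) i * (M *ᵥ ((x ε).ofLp - w.ofLp)) i ≤
        w i * affine M q w i + ε * (x ε i * w i) - ε * (x ε i * x ε i) := fun i => by
      obtain ⟨a1, a2, a3⟩ := hs i
      have h2 : (M *ᵥ ((x ε).ofLp - w.ofLp)) i =
          affine M (q + ε • x ε) (x ε) i - affine M q w i - ε * x ε i := by
        rw [Matrix.mulVec_sub, Pi.sub_apply, affine, affine]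
        simp
        ring
      rw [h2, Pi.sub_apply]
      nlinarith [mul_nonneg a1 (hMw i), mul_nonneg (hw i) a2]
    have h3 := hpsd.trans (Finset.sum_le_sum fun i _ => h1 i)
    simp only [Finset.sum_sub_distrib, Finset.sum_add_distrib, ← Finset.mul_sum, ← hC] at h3
    have h4 : ∑ i, x ε i * w i ≤ ‖x ε‖ * ‖w‖ := by
      have h := real_inner_le_norm (x ε) w
      simpa [PiLp.inner_apply, mul_comm] using h
    have h5 : ∑ i, x ε i * x ε i = ‖x ε‖ ^ 2 := by
      rw [EuclideanSpace.real_norm_sq_eq]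
      exact Finset.sum_congr rfl fun i _ => (sq _).symm
    rw [h5] at h3
    rw [norm_smul, Real.norm_of_nonneg hε.le]
    have h6 := mul_le_mul_of_nonneg_left h4 hε.le
    nlinarith
  have hC0 : 0 ≤ C := Finset.sum_nonneg fun i _ => mul_nonneg (hw i) (hMw i)
  have hlim : Filter.Tendsto (fun ε : ℝ => q + ε • x ε) (nhdsWithin 0 (Set.Ioi 0)) (nhds q) := by
    -- From `a² ≤ ε (a ‖w‖ + C)` and `2 ε a ‖w‖ ≤ a² + ε² ‖w‖²`.
    have hnorm : ∀ ε, 0 < ε → ‖ε • x ε‖ ≤ Real.sqrt (ε ^ 2 * ‖w‖ ^ 2 + 2 * ε * C) := fun ε hε => by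
      refine Real.le_sqrt_of_sq_le ?_
      nlinarith [hbound ε hε, sq_nonneg (‖ε • x ε‖ - ε * ‖w‖)]
    have h0 : Filter.Tendsto (fun ε : ℝ => ε • x ε) (nhdsWithin 0 (Set.Ioi 0)) (nhds 0) := by
      refine squeeze_zero_norm' (a := fun ε : ℝ => Real.sqrt (ε ^ 2 * ‖w‖ ^ 2 + 2 * ε * C))
        (Filter.eventually_of_mem self_mem_nhdsWithin hnorm) ?_
      have hc : Continuous fun ε : ℝ => Real.sqrt (ε ^ 2 * ‖w‖ ^ 2 + 2 * ε * C) := by fun_prop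
      have h := hc.tendsto 0
      simp only [ne_eq, OfNat.ofNat_ne_zero, not_false_eq_true, zero_pow, zero_mul, mul_zero,
        add_zero, Real.sqrt_zero] at h
      exact h.mono_left nhdsWithin_le_nhds
    simpa using h0.const_add q
  exact (isClosed_setOf_sol_nonempty M).mem_of_tendsto hlim
    (Filter.eventually_of_mem self_mem_nhdsWithin hmem)

end LCP

theorem theorem3p2 {n : ℕ} (M : Matrix (Fin n) (Fin n) ℝ) (q : EuclideanSpace ℝ (Fin n))
    (r : ℝ) (hr : 2 ≤ r) :
    (LCP.IsPSD M → (LCP.fea M q).Nonempty →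
      LCP.sol M q = LCP.stationary r M q ∧ (LCP.sol M q).Nonempty) ∧
    (LCP.IsPMatrix M →
      ∃ xstar : EuclideanSpace ℝ (Fin n),
        LCP.sol M q = LCP.stationary r M q ∧ LCP.stationary r M q = {xstar}) := by
  refine ⟨fun hM hfea => ⟨hM.sol_eq_stationary hr hfea, hM.sol_nonempty hfea⟩, fun hM => ?_⟩
  have hsol := hM.transpose.nonReversing.sol_eq_stationary hr q
  obtain ⟨x, hx⟩ := hM.nonReversing.sol_nonempty hM.transpose.nonReversing q
  refine ⟨x, hsol, ?_⟩
  rw [← hsol]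
  exact (hM.nonReversing.sol_subsingleton q).eq_singleton_of_mem hx
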